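/- Let $\mathcal H$ be a real separable Hilbert space, let $\rho$ be a probability distribution on $\mathcal H\times\mathbb R$ with marginal $\rho_{\mathcal H}$ on $\mathcal H$, and let $$\mathcal E(w)=\int_{\mathcal H\times\mathbb R}\big(\langle w,x\rangle-y\big)^2\,d\rho(x,y),\qquad w\in\mathcal H .$$ Assume that there are $M,\kappa\in\,]0,+\infty[$ with $|y|\le M$ $\rho$-almost surely and $\|x\|^2\le\kappa$ $\rho_{\mathcal H}$-almost surely, and let $\gamma\in\,]0,\kappa^{-1}]$. For every $n\ge 1$ let $(x_1,y_1),\dots,(x_n,y_n)$ be a training set of $n$ independent random pairs with distribution $\rho$, all defined on one probability space with probability measure $\mathbb P$ (the training sets for different $n$ may be the initial segments of one i.i.d. sequence, but their joint law may be arbitrary). Given a deterministic initial point $\hat w_0\in\mathcal H$, define the incremental gradient iterates $(\hat w_t)_{t\in\mathbb N}$ of the $n$-th training set by $\hat w_{t+1}=\hat u^n_t$, where $$\hat u^0_t=\hat w_t,\qquad \hat u^i_t=\hat u^{i-1}_t-\frac{\gamma}{n}\big(\langle \hat u^{i-1}_t,x_i\rangle-y_i\big)x_i,\quad i=1,\dots,n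 .$$ Let $t^*$ be a function from the positive integers to the positive integers with $$\lim_{n\to\infty}t^*(n)=+\infty\qquad\text{and}\qquad\lim_{n\to\infty}\frac{t^*(n)^3\log n}{n}=0 .$$ Then the following hold, where $\hat w_{t^*(n)}$ is the iterate computed from the $n$-th training set. (i) For every initial point $\hat w_0\in\mathcal H$, $\ \lim_{n\to\infty}\mathcal E(\hat w_{t^*(n)})-\inf_{w\in\mathcal H}\mathcal E(w)=0$ $\ \mathbb P$-almost surely. (ii) If the set $\mathcal O$ of minimizers of $\mathcal E$ over $\mathcal H$ is nonempty, then it has a unique element $w^\dagger$ of minimal norm, and for the initial point $\hat w_0=0$, $\ \|\hat w_{t^*(n)}-w^\dagger\|\to 0$ $\ \mathbb P$-almost surely. -/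

import Mathlib

open MeasureTheory ProbabilityTheory Filter Topology

noncomputable section

namespace IncrementalLearning

variable {H : Type*} [NormedAddCommGroup H] [InnerProductSpace ℝ H]

/-- The risk `w ↦ ∫ (⟪w, x⟫ - y)² dρ(x, y)` of the square loss. -/
def risk [MeasurableSpace H] (ρ : Measure (H × ℝ)) (w : H) : ℝ :=
  ∫ z, (inner ℝ w z.1 - z.2) ^ 2 ∂ρ

/-- The set of minimizers of the risk over `H`. -/
def minimizers [MeasurableSpace H] (ρ : Measure (H × ℝ)) : Set H :=
  {w | IsMinOn (risk ρ) Set.univ w}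

/-- `w` is a minimizer of the risk whose norm is minimal among all minimizers. -/
def IsMinNormMinimizer [MeasurableSpace H] (ρ : Measure (H × ℝ)) (w : H) : Prop :=
  w ∈ minimizers ρ ∧ IsMinOn (fun v : H => ‖v‖) (minimizers ρ) w

/-- One incremental gradient step, with step size `η`, on the data point `z = (x, y)`:
`u ↦ u - η (⟪u, x⟫ - y) x`. -/
def gradStep (η : ℝ) (z : H × ℝ) (u : H) : H :=
  u - (η * (inner ℝ u z.1 - z.2)) • z.1

/-- The inner iterates `u⁰, …, uⁿ` of one cycle over the training set `z`, started at `u⁰ = w`: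
`uⁱ⁺¹` is obtained from `uⁱ` by a gradient step of size `γ / n` on the `(i+1)`-st data point
(data points are numbered from `0` here). -/
def cycle (γ : ℝ) {n : ℕ} (z : Fin n → H × ℝ) (w : H) (i : Fin (n + 1)) : H :=
  Fin.induction (motive := fun _ => H) w (fun j u => gradStep (γ / n) (z j) u) i

/-- The iterates after each epoch: `ŵ₀ = w₀`, and `ŵ_{t+1}` is the last inner iterate of the
cycle over the training set started at `ŵ_t`. -/
def iterate (γ : ℝ) {n : ℕ} (z : Fin n → H × ℝ) (w₀ : H) : ℕ → H
  | 0 => w₀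
  | t + 1 => cycle γ z (iterate γ z w₀ t) (Fin.last n)

end IncrementalLearning

end

/-!
A pass of the incremental gradient method over `n` data points is compared with `n` gradient steps
of size `γ / n` for the population functional `quad T b w = ⟪T w, w⟫ - 2 ⟪b, w⟫`, where
`T = 𝔼 x ⊗ x` (`covOp`) and `b = 𝔼 y x` (`crossVec`), so that the risk is `quad T b` plus a constant.
The step size of this reference iteration depends on `n`; everything about it is therefore estimated
in terms of the elapsed step size `k η = γ t` only.

*Reference iteration.* For `η κ ≤ 1`, gradient descent satisfies
`‖w_k - u‖² + k η (quad w_k - quad u) ≤ ‖w₀ - u‖²` for every `u` (`norm_iterate_sub_sq_le`).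
Arbitrary `u` give convergence of the values to the infimum, even if it is not attained
(`tendsto_quad_iterate`); `u = w₀` shows that the iterates grow at most like `√t`
(`IsBoundedLaw.norm_iterate_le`); and `b = 0` gives decay of the homogeneous iteration on the range of
`T`, which is dense in the orthogonal complement of `ker T`, whence convergence to the solution of
minimal norm (`tendsto_iterate_gdStep`).

*Deviation.* A pass is nonexpansive, so the error after `t` epochs is at most the sum of the errors
of single passes started at the deterministic points of the reference iteration
(`norm_iterate_pass_sub_le`); no operator norm concentration is needed. For one such pass, the
distance `D` to the reference iterate satisfies `D'² ≤ D² + 2 η ⟪d, ζ⟫ + 2 η² B²` with a centred noise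
`ζ` bounded by `B`, and Hoeffding's lemma bounds the exponential moment of `a D²` step by step
(`IsBoundedLaw.lintegral_exp_pass_le`). This yields the dimension-free tail
`ℙ(D ≥ r) ≤ 2 exp (-n r² / (8 γ² B²))`. With `B = O(√t)`, `r = δ / t` and a union bound over the
epochs, an error of at least `δ` has probability at most `2 t exp (-c n / t³)`
(`IsBoundedLaw.measure_iterate_sub_ge_le`). This is summable in `n` because
`t³ log n = o(n)`, and the Borel–Cantelli lemma concludes, whatever the joint law of the training
sets.
-/

noncomputable section

namespace IncrementalLearning

open scoped InnerProductSpace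

/-! ### Gradient descent on a quadratic functional -/

section Quadratic

variable {H : Type*} [NormedAddCommGroup H] [InnerProductSpace ℝ H]

/-- `0 ≤ T ≤ κ` in the sense of quadratic forms, for a symmetric operator `T`. -/
structure IsBetweenZeroAnd (κ : ℝ) (T : H →L[ℝ] H) : Prop where
  symm : ∀ u v, ⟪T u, v⟫_ℝ = ⟪u, T v⟫_ℝ
  nonneg : ∀ u, 0 ≤ ⟪T u, u⟫_ℝ
  le : ∀ u, ⟪T u, u⟫_ℝ ≤ κ * ‖u‖ ^ 2

/-- The quadratic functional `w ↦ ⟪T w, w⟫ - 2 ⟪b, w⟫`; its gradient at `w` is `2 (T w - b)`. -/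
def quad (T : H →L[ℝ] H) (b w : H) : ℝ := ⟪T w, w⟫_ℝ - 2 * ⟪b, w⟫_ℝ

/-- A gradient step `w ↦ w - η (T w - b)` for half the functional `quad T b`. -/
def gdStep (T : H →L[ℝ] H) (b : H) (η : ℝ) (w : H) : H := w - η • (T w - b)

variable {T : H →L[ℝ] H} {b : H} {κ η : ℝ}

lemma quad_sub (hT : IsBetweenZeroAnd κ T) (w u : H) :
    quad T b w - quad T b u = 2 * ⟪T u - b, w - u⟫_ℝ + ⟪T (w - u), w - u⟫_ℝ := by
  have h1 := hT.symm w u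
  have h2 := real_inner_comm w (T u)
  simp only [quad, map_sub, inner_sub_left, inner_sub_right]
  linarith

/-- Each step decreases the functional by at least `η ‖∇‖²`. -/
lemma quad_gdStep_le (hT : IsBetweenZeroAnd κ T) (hη : 0 ≤ η) (hηκ : η * κ ≤ 1) (w : H) :
    quad T b (gdStep T b η w) + η * ‖T w - b‖ ^ 2 ≤ quad T b w := by
  set g := T w - b with hg
  have h := quad_sub (b := b) hT (gdStep T b η w) w
  have hd : gdStep T b η w - w = -(η • g) := by simp [gdStep, hg]
  rw [hd, ← hg] at h
  simp only [map_neg, map_smul, inner_neg_left, inner_neg_right, real_inner_smul_left,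
    real_inner_smul_right, real_inner_self_eq_norm_sq] at h
  have h1 : η * (η * ⟪T g, g⟫_ℝ) ≤ η * ‖g‖ ^ 2 := by
    refine mul_le_mul_of_nonneg_left ?_ hη
    calc η * ⟪T g, g⟫_ℝ ≤ η * (κ * ‖g‖ ^ 2) := mul_le_mul_of_nonneg_left (hT.le g) hη
      _ = (η * κ) * ‖g‖ ^ 2 := by ring
      _ ≤ 1 * ‖g‖ ^ 2 := by gcongr
      _ = ‖g‖ ^ 2 := one_mul _
  linarith

lemma quad_iterate_antitone (hT : IsBetweenZeroAnd κ T) (hη : 0 ≤ η) (hηκ : η * κ ≤ 1) (w : H) :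
    Antitone fun k => quad T b ((gdStep T b η)^[k] w) := by
  refine antitone_nat_of_succ_le fun k => ?_
  rw [Function.iterate_succ_apply']
  have := quad_gdStep_le (b := b) hT hη hηκ ((gdStep T b η)^[k] w)
  have h2 : 0 ≤ η * ‖T ((gdStep T b η)^[k] w) - b‖ ^ 2 := by positivity
  linarith

/-- The distance to an arbitrary reference point `u` is a Lyapunov function, up to the value
of the functional at `u`. -/
lemma norm_gdStep_sub_sq_le (hT : IsBetweenZeroAnd κ T) (hη : 0 ≤ η) (hηκ : η * κ ≤ 1)
    (w u : H) :
    ‖gdStep T b η w - u‖ ^ 2 + η * (quad T b (gdStep T b η w) - quad T b u) ≤ ‖w - u‖ ^ 2 := by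
  have h1 := quad_gdStep_le (b := b) hT hη hηκ w
  have h2 := quad_sub (b := b) hT u w
  have h3 := hT.nonneg (u - w)
  have hd : gdStep T b η w - u = (w - u) - η • (T w - b) := by simp only [gdStep]; abel
  rw [hd, norm_sub_sq_real, real_inner_smul_right, norm_smul, mul_pow, Real.norm_eq_abs, sq_abs,
    real_inner_comm]
  rw [← neg_sub w u, inner_neg_right] at h2
  rw [← neg_sub w u] at h3
  have h4 : η * (quad T b (gdStep T b η w) - quad T b u + η * ‖T w - b‖ ^ 2)
      ≤ η * (2 * ⟪T w - b, w - u⟫_ℝ) := mul_le_mul_of_nonneg_left (by linarith) hη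
  linarith

/-- With `k` steps of size `η`, the excess over `u` is at most `‖w - u‖² / (k η)`; with `u = w`
this bounds the displacement `‖w_k - w‖²` by `k η` times the total decrease. -/
lemma norm_iterate_sub_sq_le (hT : IsBetweenZeroAnd κ T) (hη : 0 ≤ η) (hηκ : η * κ ≤ 1)
    (w u : H) (k : ℕ) :
    ‖(gdStep T b η)^[k] w - u‖ ^ 2 + k * η * (quad T b ((gdStep T b η)^[k] w) - quad T b u)
      ≤ ‖w - u‖ ^ 2 := by
  induction k with
  | zero => simp
  | succ k ih =>
    have h1 := norm_gdStep_sub_sq_le (b := b) hT hη hηκ ((gdStep T b η)^[k] w) u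
    have h2 := quad_iterate_antitone (b := b) hT hη hηκ w (Nat.le_succ k)
    simp only [Nat.succ_eq_add_one, Function.iterate_succ_apply'] at h2 ⊢
    have h3 := mul_le_mul_of_nonneg_left h2 (mul_nonneg k.cast_nonneg hη)
    push_cast
    linarith

/-- The gradient is controlled by the excess: one step of size `1 / κ` gains `‖∇‖² / κ`. -/
lemma norm_grad_sq_le (hT : IsBetweenZeroAnd κ T) (hκ : 0 < κ) {m : ℝ}
    (hm : ∀ w, m ≤ quad T b w) (w : H) : ‖T w - b‖ ^ 2 ≤ κ * (quad T b w - m) := by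
  have h := quad_gdStep_le (b := b) hT (inv_nonneg.2 hκ.le) (inv_mul_cancel₀ hκ.ne').le w
  have h2 := hm (gdStep T b κ⁻¹ w)
  have h3 : κ⁻¹ * ‖T w - b‖ ^ 2 ≤ quad T b w - m := by linarith
  calc ‖T w - b‖ ^ 2 = κ * (κ⁻¹ * ‖T w - b‖ ^ 2) := by field_simp
    _ ≤ _ := by gcongr

lemma isMinOn_quad_iff (hT : IsBetweenZeroAnd κ T) (hκ : 0 < κ) (w : H) :
    IsMinOn (quad T b) Set.univ w ↔ T w = b := by
  constructor
  · intro h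
    have h1 := norm_grad_sq_le (b := b) hT hκ (m := quad T b w)
      (fun v => h (Set.mem_univ v)) w
    have h2 : ‖T w - b‖ ^ 2 ≤ 0 := by simpa using h1
    exact sub_eq_zero.1 (norm_eq_zero.1 (pow_eq_zero_iff two_ne_zero |>.1
      (le_antisymm h2 (sq_nonneg _))))
  · intro h v _
    have h1 := quad_sub (b := b) hT v w
    have h2 := hT.nonneg (v - w)
    simp only [h, sub_self, inner_zero_left, mul_zero, zero_add] at h1
    change quad T b w ≤ quad T b v
    linarith

/-- The values of gradient descent converge to the infimum, attained or not, as the product of the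
step size and the number of steps diverges; the step size may vary. -/
lemma tendsto_quad_iterate (hT : IsBetweenZeroAnd κ T) (hbdd : BddBelow (Set.range (quad T b)))
    {ι : Type*} {l : Filter ι} {s : ι → ℝ} {k : ι → ℕ} (hs : ∀ᶠ i in l, 0 ≤ s i ∧ s i * κ ≤ 1)
    (hks : Tendsto (fun i => k i * s i) l atTop) (w : H) :
    Tendsto (fun i => quad T b ((gdStep T b (s i))^[k i] w)) l (𝓝 (⨅ u, quad T b u)) := by
  rw [Metric.tendsto_nhds]
  intro ε hε
  obtain ⟨u, hu⟩ := exists_lt_of_ciInf_lt (lt_add_of_pos_right (⨅ u, quad T b u) (half_pos hε))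
  filter_upwards [hs, hks.eventually_gt_atTop (‖w - u‖ ^ 2 / (ε / 2)),
    hks.eventually_gt_atTop 0] with i hi hki hki0
  have h1 := ciInf_le hbdd ((gdStep T b (s i))^[k i] w)
  have h2 := norm_iterate_sub_sq_le (b := b) hT hi.1 hi.2 w u (k i)
  rw [Real.dist_eq, abs_of_nonneg (sub_nonneg.2 h1)]
  rw [div_lt_iff₀ (half_pos hε)] at hki
  have h3 : quad T b ((gdStep T b (s i))^[k i] w) - quad T b u < ε / 2 := by
    refine lt_of_mul_lt_mul_left ?_ hki0.le
    linarith [sq_nonneg ‖(gdStep T b (s i))^[k i] w - u‖]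
  linarith

/-- Along a sequence on which `quad T b` is bounded, vanishing perturbations do not change its
values in the limit: the gradients are bounded there. -/
lemma tendsto_quad_sub_quad (hT : IsBetweenZeroAnd κ T) (hκ : 0 < κ) {m Q : ℝ}
    (hm : ∀ w, m ≤ quad T b w) {ι : Type*} {l : Filter ι} {v w : ι → H}
    (hv : ∀ᶠ i in l, quad T b (v i) ≤ Q) (hwv : Tendsto (fun i => ‖w i - v i‖) l (𝓝 0)) :
    Tendsto (fun i => quad T b (w i) - quad T b (v i)) l (𝓝 0) := by
  have h0 : Tendsto (fun i => 2 * (√(κ * (Q - m)) * ‖w i - v i‖) + κ * ‖w i - v i‖ ^ 2) l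
      (𝓝 0) := by
    simpa using ((hwv.const_mul √(κ * (Q - m))).const_mul 2).add ((hwv.pow 2).const_mul κ)
  refine squeeze_zero_norm' ?_ h0
  filter_upwards [hv] with i hi
  rw [quad_sub hT, Real.norm_eq_abs]
  refine (abs_add_le _ _).trans (add_le_add ?_ ?_)
  · rw [abs_mul, abs_two]
    have hg : ‖T (v i) - b‖ ≤ √(κ * (Q - m)) :=
      Real.le_sqrt_of_sq_le ((norm_grad_sq_le hT hκ hm (v i)).trans (by gcongr))
    have := abs_real_inner_le_norm (T (v i) - b) (w i - v i)
    have := mul_le_mul_of_nonneg_right hg (norm_nonneg (w i - v i))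
    linarith
  · rw [abs_of_nonneg (hT.nonneg _)]
    exact hT.le _

/-- The deviation from a solution of `T u = b` follows the recursion with `b = 0`. -/
lemma iterate_gdStep_sub {u : H} (hu : T u = b) (w : H) (k : ℕ) :
    (gdStep T b η)^[k] w - u = (gdStep T 0 η)^[k] (w - u) := by
  induction k with
  | zero => rfl
  | succ k ih =>
    rw [Function.iterate_succ_apply', Function.iterate_succ_apply', ← ih]
    simp only [gdStep, map_sub, hu, sub_zero]
    abel

lemma iterate_gdStep_zero_sub (w v : H) (k : ℕ) :
    (gdStep T 0 η)^[k] (w - v) = (gdStep T 0 η)^[k] w - (gdStep T 0 η)^[k] v := by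
  induction k with
  | zero => rfl
  | succ k ih =>
    simp only [Function.iterate_succ_apply', ih, gdStep, map_sub, sub_zero, smul_sub]
    abel

lemma iterate_gdStep_zero_map (w : H) (k : ℕ) :
    (gdStep T 0 η)^[k] (T w) = T ((gdStep T 0 η)^[k] w) := by
  induction k with
  | zero => rfl
  | succ k ih => simp only [Function.iterate_succ_apply', ih, gdStep, map_sub, map_smul, sub_zero]

lemma norm_iterate_gdStep_zero_le (hT : IsBetweenZeroAnd κ T) (hη : 0 ≤ η) (hηκ : η * κ ≤ 1)
    (w : H) (k : ℕ) : ‖(gdStep T 0 η)^[k] w‖ ≤ ‖w‖ := by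
  have h := norm_iterate_sub_sq_le (b := 0) hT hη hηκ w 0 k
  have h1 := hT.nonneg ((gdStep T 0 η)^[k] w)
  have h2 : 0 ≤ k * η * ⟪T ((gdStep T 0 η)^[k] w), (gdStep T 0 η)^[k] w⟫_ℝ := by positivity
  simp only [quad, sub_zero, inner_zero_left, mul_zero, map_zero] at h
  exact le_of_sq_le_sq (by linarith) (norm_nonneg _)

/-- On the range of `T`, the homogeneous iterates decay like `(k η)^(-1/2)`. -/
lemma norm_iterate_gdStep_zero_map_sq_le (hT : IsBetweenZeroAnd κ T) (hκ : 0 < κ) (hη : 0 ≤ η)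
    (hηκ : η * κ ≤ 1) (w : H) (k : ℕ) :
    k * η * ‖(gdStep T 0 η)^[k] (T w)‖ ^ 2 ≤ κ * ‖w‖ ^ 2 := by
  rw [iterate_gdStep_zero_map]
  set v := (gdStep T 0 η)^[k] w with hv
  have h := norm_iterate_sub_sq_le (b := 0) hT hη hηκ w 0 k
  rw [← hv] at h
  have h1 := norm_grad_sq_le (b := 0) hT hκ (m := 0) (fun w => by
    simpa [quad] using hT.nonneg w) v
  simp only [quad, sub_zero, inner_zero_left, mul_zero, map_zero] at h h1
  have h2 : k * η * ‖T v‖ ^ 2 ≤ k * η * (κ * ⟪T v, v⟫_ℝ) := by gcongr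
  nlinarith [sq_nonneg ‖v‖, mul_le_mul_of_nonneg_left h hκ.le]

/-- Gradient descent from `0` converges to the solution of `T w = b` orthogonal to the kernel,
as the product of the step size and the number of steps diverges; the step size may vary. -/
lemma tendsto_iterate_gdStep [CompleteSpace H] (hT : IsBetweenZeroAnd κ T) (hκ : 0 < κ)
    {ι : Type*} {l : Filter ι} {s : ι → ℝ} {k : ι → ℕ} (hs : ∀ᶠ i in l, 0 ≤ s i ∧ s i * κ ≤ 1)
    (hks : Tendsto (fun i => k i * s i) l atTop) {u : H} (hu : T u = b)
    (huT : u ∈ (T.ker)ᗮ) :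
    Tendsto (fun i => (gdStep T b (s i))^[k i] 0) l (𝓝 u) := by
  have hTa : ContinuousLinearMap.adjoint T = T :=
    ((ContinuousLinearMap.eq_adjoint_iff T T).2 hT.symm).symm
  rw [ContinuousLinearMap.orthogonal_ker, hTa] at huT
  have hcl : u ∈ closure (Set.range T) := by simpa using! huT
  rw [Metric.tendsto_nhds]
  intro ε hε
  obtain ⟨_, ⟨v, rfl⟩, hv⟩ := Metric.mem_closure_iff.1 hcl (ε / 2) (half_pos hε)
  filter_upwards [hs, hks.eventually_gt_atTop (κ * ‖v‖ ^ 2 / (ε / 2) ^ 2)] with i hi hki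
  rw [dist_eq_norm, iterate_gdStep_sub hu, iterate_gdStep_zero_sub, ← neg_sub, norm_neg]
  have h0 : (gdStep T 0 (s i))^[k i] 0 = 0 :=
    norm_le_zero_iff.1 (by simpa using norm_iterate_gdStep_zero_le hT hi.1 hi.2 0 (k i))
  rw [h0, sub_zero]
  have h1 := norm_iterate_gdStep_zero_le hT hi.1 hi.2 (u - T v) (k i)
  rw [iterate_gdStep_zero_sub] at h1
  have h2 := norm_iterate_gdStep_zero_map_sq_le hT hκ hi.1 hi.2 v (k i)
  set a := (gdStep T 0 (s i))^[k i] u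
  set c := (gdStep T 0 (s i))^[k i] (T v)
  have h3 : ‖c‖ < ε / 2 := by
    by_contra! hc
    have hp : (ε / 2) ^ 2 ≤ ‖c‖ ^ 2 := by gcongr
    rw [div_lt_iff₀ (by positivity)] at hki
    have h0' : (0 : ℝ) ≤ k i * s i := mul_nonneg (Nat.cast_nonneg _) hi.1
    nlinarith [mul_le_mul_of_nonneg_left hp h0']
  rw [dist_eq_norm] at hv
  calc ‖a‖ = ‖(a - c) + c‖ := by simp
    _ ≤ ‖a - c‖ + ‖c‖ := norm_add_le _ _
    _ < ε := by linarith

end Quadratic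

/-! ### The population operator -/

section Population

variable {H : Type*} [NormedAddCommGroup H] [InnerProductSpace ℝ H]
  [MeasurableSpace H]

/-- The (uncentred) covariance operator `w ↦ ∫ ⟪x, w⟫ x dρ(x, y)`. -/
def covOp (ρ : Measure (H × ℝ)) : H →L[ℝ] H :=
  ∫ z, InnerProductSpace.rankOne ℝ z.1 z.1 ∂ρ

/-- The vector `∫ y x dρ(x, y)`. -/
def crossVec (ρ : Measure (H × ℝ)) : H := ∫ z, z.2 • z.1 ∂ρ

/-- Almost surely `|y| ≤ M` and `‖x‖² ≤ κ`. -/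
def IsBoundedLaw (M κ : ℝ) (ρ : Measure (H × ℝ)) : Prop :=
  ∀ᵐ z ∂ρ, |z.2| ≤ M ∧ ‖z.1‖ ^ 2 ≤ κ

variable {ρ : Measure (H × ℝ)} {M κ : ℝ}

lemma IsBoundedLaw.abs_residual_le (h : IsBoundedLaw M κ ρ) (w : H) :
    ∀ᵐ z ∂ρ, |⟪w, z.1⟫_ℝ - z.2| ≤ √κ * ‖w‖ + M := by
  filter_upwards [h] with z hz
  have hz' := Real.le_sqrt_of_sq_le hz.2
  calc |⟪w, z.1⟫_ℝ - z.2| ≤ |⟪w, z.1⟫_ℝ| + |z.2| := abs_sub _ _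
    _ ≤ ‖w‖ * ‖z.1‖ + M := add_le_add (abs_real_inner_le_norm _ _) hz.1
    _ ≤ √κ * ‖w‖ + M := by nlinarith [norm_nonneg w]

lemma IsBoundedLaw.norm_gradient_le (h : IsBoundedLaw M κ ρ) (w : H) :
    ∀ᵐ z ∂ρ, ‖(⟪w, z.1⟫_ℝ - z.2) • z.1‖ ≤ (√κ * ‖w‖ + M) * √κ := by
  filter_upwards [h, h.abs_residual_le w] with z hz h1
  have h2 := Real.le_sqrt_of_sq_le hz.2
  rw [norm_smul, Real.norm_eq_abs]
  exact mul_le_mul h1 h2 (norm_nonneg _) ((abs_nonneg _).trans h1)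

variable [SecondCountableTopology H] [BorelSpace H] [IsProbabilityMeasure ρ]

lemma IsBoundedLaw.integrable_gradient (h : IsBoundedLaw M κ ρ) (w : H) :
    Integrable (fun z : H × ℝ => (⟪w, z.1⟫_ℝ - z.2) • z.1) ρ :=
  .of_bound (Continuous.aestronglyMeasurable (by fun_prop)) _ (h.norm_gradient_le w)

lemma IsBoundedLaw.integrable_crossVec (h : IsBoundedLaw M κ ρ) :
    Integrable (fun z : H × ℝ => z.2 • z.1) ρ := by
  simpa using (h.integrable_gradient 0).neg

lemma IsBoundedLaw.integrable_covOp (h : IsBoundedLaw M κ ρ) (w : H) :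
    Integrable (fun z : H × ℝ => ⟪w, z.1⟫_ℝ • z.1) ρ := by
  have := (h.integrable_gradient w).add h.integrable_crossVec
  refine this.congr (.of_forall fun z => ?_)
  simp [sub_smul]

lemma IsBoundedLaw.integrable_rankOne (h : IsBoundedLaw M κ ρ) :
    Integrable (fun z : H × ℝ => InnerProductSpace.rankOne ℝ z.1 z.1) ρ := by
  have : SecondCountableTopologyEither (H × ℝ) (H →L[ℝ] H) :=
    secondCountableTopologyEither_of_left (H × ℝ) (H →L[ℝ] H)
  refine Integrable.of_bound (Continuous.aestronglyMeasurable ?_) κ ?_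
  · exact ((InnerProductSpace.rankOne ℝ).continuous.comp continuous_fst).clm_apply continuous_fst
  · filter_upwards [h] with z hz
    simpa [pow_two] using hz.2

lemma IsBoundedLaw.covOp_apply (h : IsBoundedLaw M κ ρ) (w : H) :
    covOp ρ w = ∫ z, ⟪w, z.1⟫_ℝ • z.1 ∂ρ := by
  rw [covOp, ContinuousLinearMap.integral_apply h.integrable_rankOne]
  simp [real_inner_comm]

/-- `T w - b` is half the gradient of the risk. -/
lemma IsBoundedLaw.integral_gradient (h : IsBoundedLaw M κ ρ) (w : H) :
    ∫ z, (⟪w, z.1⟫_ℝ - z.2) • z.1 ∂ρ = covOp ρ w - crossVec ρ := by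
  rw [h.covOp_apply, crossVec, ← integral_sub (h.integrable_covOp w) h.integrable_crossVec]
  simp [sub_smul]

variable [CompleteSpace H]

lemma IsBoundedLaw.inner_covOp (h : IsBoundedLaw M κ ρ) (u v : H) :
    ⟪u, covOp ρ v⟫_ℝ = ∫ z, ⟪u, z.1⟫_ℝ * ⟪v, z.1⟫_ℝ ∂ρ := by
  rw [h.covOp_apply, ← integral_inner (h.integrable_covOp v)]
  simp [real_inner_smul_right, mul_comm]

lemma IsBoundedLaw.isBetweenZeroAnd_covOp (h : IsBoundedLaw M κ ρ) :
    IsBetweenZeroAnd κ (covOp ρ) where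
  symm u v := by
    rw [real_inner_comm, h.inner_covOp, h.inner_covOp]
    simp [mul_comm]
  nonneg u := by
    rw [real_inner_comm, h.inner_covOp]
    exact integral_nonneg fun z => mul_self_nonneg _
  le u := by
    rw [real_inner_comm, h.inner_covOp]
    have h1 : ∀ᵐ z ∂ρ, ⟪u, z.1⟫_ℝ * ⟪u, z.1⟫_ℝ ≤ κ * ‖u‖ ^ 2 := by
      filter_upwards [h] with z hz
      have h2 := real_inner_mul_inner_self_le u z.1
      rw [real_inner_self_eq_norm_sq, real_inner_self_eq_norm_sq] at h2
      nlinarith [mul_le_mul_of_nonneg_left hz.2 (sq_nonneg ‖u‖)]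
    calc _ ≤ ∫ _ : H × ℝ, κ * ‖u‖ ^ 2 ∂ρ :=
          integral_mono_of_nonneg (.of_forall fun z => mul_self_nonneg _)
            (integrable_const _) h1
      _ = _ := by simp

lemma IsBoundedLaw.risk_eq (h : IsBoundedLaw M κ ρ) (w : H) :
    risk ρ w = quad (covOp ρ) (crossVec ρ) w + ∫ z, z.2 ^ 2 ∂ρ := by
  have i1 : Integrable (fun z : H × ℝ => ⟪w, z.1⟫_ℝ * ⟪w, z.1⟫_ℝ) ρ := by
    simpa [real_inner_smul_right] using (h.integrable_covOp w).const_inner (𝕜 := ℝ) w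
  have i2 : Integrable (fun z : H × ℝ => ⟪w, z.2 • z.1⟫_ℝ) ρ :=
    h.integrable_crossVec.const_inner (𝕜 := ℝ) w
  have i3 : Integrable (fun z : H × ℝ => z.2 ^ 2) ρ := by
    refine .of_bound (Continuous.aestronglyMeasurable (by fun_prop)) (M ^ 2) ?_
    filter_upwards [h] with z hz
    simpa using sq_le_sq' (by linarith [(abs_le.1 hz.1).1]) (abs_le.1 hz.1).2
  rw [quad, real_inner_comm, h.inner_covOp, real_inner_comm, crossVec,
    ← integral_inner h.integrable_crossVec, ← integral_const_mul, ← integral_sub i1 (i2.const_mul 2),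
    ← integral_add (f := fun z : H × ℝ => _ - _) (i1.sub (i2.const_mul 2)) i3, risk]
  refine integral_congr_ae (.of_forall fun z => ?_)
  simp only [real_inner_smul_right]
  ring

lemma IsBoundedLaw.mem_minimizers_iff (h : IsBoundedLaw M κ ρ) (hκ : 0 < κ) (w : H) :
    w ∈ minimizers ρ ↔ covOp ρ w = crossVec ρ := by
  rw [← isMinOn_quad_iff h.isBetweenZeroAnd_covOp hκ]
  simp [minimizers, IsMinOn, IsMinFilter, h.risk_eq]

end Population

/-! ### The minimizer of minimal norm -/

/-- The solutions of a consistent linear equation `T w = b` have exactly one element of minimal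
norm, and it is orthogonal to the kernel of `T`. -/
lemma exists_minNorm_solution {H : Type*} [NormedAddCommGroup H] [InnerProductSpace ℝ H]
    [CompleteSpace H] (T : H →L[ℝ] H) (b : H) (hb : ∃ w, T w = b) :
    ∃ u, T u = b ∧ u ∈ (T.ker)ᗮ ∧ ∀ v, T v = b → ‖u‖ ≤ ‖v‖ ∧ (‖v‖ ≤ ‖u‖ → v = u) := by
  obtain ⟨w, hw⟩ := hb
  have : CompleteSpace T.ker := T.isClosed_ker.completeSpace_coe
  set p : H := T.ker.starProjection w
  have hp : T p = 0 := T.ker.starProjection_apply_mem w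
  have hu : w - p ∈ (T.ker)ᗮ := T.ker.sub_starProjection_mem_orthogonal w
  refine ⟨w - p, by simp [hw, hp], hu, fun v hv => ?_⟩
  have hd : v - (w - p) ∈ T.ker := by simp [hv, hw, hp]
  have h1 : ‖v‖ * ‖v‖ = ‖w - p‖ * ‖w - p‖ + ‖v - (w - p)‖ * ‖v - (w - p)‖ := by
    rw [← norm_add_sq_eq_norm_sq_add_norm_sq_real
      (Submodule.inner_left_of_mem_orthogonal hd hu)]
    simp
  refine ⟨abs_le_of_sq_le_sq' ?_ (norm_nonneg _) |>.2, fun hle => ?_⟩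
  · nlinarith [mul_self_nonneg ‖v - (w - p)‖]
  · refine sub_eq_zero.1 (norm_eq_zero.1 (mul_self_eq_zero.1 (le_antisymm ?_ (mul_self_nonneg _))))
    nlinarith [norm_nonneg v, norm_nonneg (w - p)]

/-! ### One pass over the data -/

section Pass

variable {H : Type*} [NormedAddCommGroup H] [InnerProductSpace ℝ H]

/-- One pass of gradient steps of size `η` over the data points `z 0, z 1, …` in this order,
started at `w`. -/
def pass (η : ℝ) {n : ℕ} (z : Fin n → H × ℝ) (w : H) : H :=
  Fin.foldl n (fun u i => gradStep η (z i) u) w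

lemma pass_succ (η : ℝ) {n : ℕ} (z : Fin (n + 1) → H × ℝ) (w : H) :
    pass η z w = pass η (fun i : Fin n => z i.succ) (gradStep η (z 0) w) :=
  Fin.foldl_succ _ _

lemma pass_succ_last (η : ℝ) {n : ℕ} (z : Fin (n + 1) → H × ℝ) (w : H) :
    pass η z w = gradStep η (z (Fin.last n)) (pass η (fun i : Fin n => z i.castSucc) w) :=
  Fin.foldl_succ_last _ _

lemma cycle_last (γ : ℝ) {n : ℕ} (z : Fin n → H × ℝ) (w : H) :
    cycle γ z w (Fin.last n) = pass (γ / n) z w := by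
  have key : ∀ (η : ℝ) (m : ℕ) (z : Fin m → H × ℝ),
      Fin.induction (motive := fun _ => H) w (fun j u => gradStep η (z j) u) (Fin.last m)
        = pass η z w := by
    intro η m
    induction m with
    | zero => intro z; rfl
    | succ m ih =>
      intro z
      rw [pass_succ_last, ← ih, ← Fin.succ_last, Fin.induction_succ]
      congr 1
      generalize Fin.last m = i
      induction i using Fin.induction with
      | zero => rfl
      | succ i ih => rw [← Fin.succ_castSucc, Fin.induction_succ, Fin.induction_succ, ih]
  exact key _ _ _

lemma iterate_eq_pass (γ : ℝ) {n : ℕ} (z : Fin n → H × ℝ) (w : H) (t : ℕ) :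
    iterate γ z w t = (pass (γ / n) z)^[t] w := by
  induction t with
  | zero => rfl
  | succ t ih => rw [Function.iterate_succ_apply', ← ih, iterate, cycle_last]

lemma continuous_pass (η : ℝ) (n : ℕ) (w : H) :
    Continuous fun z : Fin n → H × ℝ => pass η z w := by
  induction n with
  | zero => exact continuous_const
  | succ n ih =>
    simp only [pass_succ_last, gradStep]
    have h : Continuous fun z : Fin (n + 1) → H × ℝ => pass η (fun i : Fin n => z i.castSucc) w :=
      ih.comp (by fun_prop)
    fun_prop

variable {η κ : ℝ}

lemma norm_sub_smul_inner_sq_le (hη : 0 ≤ η) {x : H} (hx : η * ‖x‖ ^ 2 ≤ 1) (d : H) :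
    ‖d - (η * ⟪d, x⟫_ℝ) • x‖ ^ 2 ≤ ‖d‖ ^ 2 - η * ⟪d, x⟫_ℝ ^ 2 := by
  rw [norm_sub_sq_real, real_inner_smul_right, norm_smul, mul_pow, Real.norm_eq_abs, sq_abs]
  have h : η * ⟪d, x⟫_ℝ ^ 2 * (η * ‖x‖ ^ 2) ≤ η * ⟪d, x⟫_ℝ ^ 2 * 1 :=
    mul_le_mul_of_nonneg_left hx (by positivity)
  linarith

lemma norm_gradStep_sub_gradStep_le (hη : 0 ≤ η) {z : H × ℝ} (hz : η * ‖z.1‖ ^ 2 ≤ 1) (u v : H) :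
    ‖gradStep η z u - gradStep η z v‖ ≤ ‖u - v‖ := by
  have h := norm_sub_smul_inner_sq_le hη hz (u - v)
  have hd : gradStep η z u - gradStep η z v = (u - v) - (η * ⟪u - v, z.1⟫_ℝ) • z.1 := by
    simp only [gradStep, inner_sub_left, mul_sub, sub_smul]
    abel
  rw [hd]
  exact abs_le_of_sq_le_sq' (h.trans (sub_le_self _ (by positivity))) (norm_nonneg _) |>.2

lemma norm_pass_sub_pass_le (hη : 0 ≤ η) {n : ℕ} {z : Fin n → H × ℝ}
    (hz : ∀ i, η * ‖(z i).1‖ ^ 2 ≤ 1) (u v : H) : ‖pass η z u - pass η z v‖ ≤ ‖u - v‖ := by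
  induction n with
  | zero => exact le_rfl
  | succ n ih =>
    rw [pass_succ_last, pass_succ_last]
    exact (norm_gradStep_sub_gradStep_le hη (hz _) _ _).trans (ih fun i => hz _)

/-- Since a pass is nonexpansive, the errors against any other iteration `f` just add up, and each
of them is the error of a single pass started at a point of the *other* iteration. -/
lemma norm_iterate_pass_sub_le (hη : 0 ≤ η) {n : ℕ} {z : Fin n → H × ℝ}
    (hz : ∀ i, η * ‖(z i).1‖ ^ 2 ≤ 1) (f : H → H) (w : H) (t : ℕ) :
    ‖(pass η z)^[t] w - f^[t] w‖
      ≤ ∑ s ∈ Finset.range t, ‖pass η z (f^[s] w) - f (f^[s] w)‖ := by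
  induction t with
  | zero => simp
  | succ t ih =>
    rw [Function.iterate_succ_apply', Function.iterate_succ_apply', Finset.sum_range_succ]
    calc _ ≤ ‖pass η z ((pass η z)^[t] w) - pass η z (f^[t] w)‖
          + ‖pass η z (f^[t] w) - f (f^[t] w)‖ := norm_sub_le_norm_sub_add_norm_sub _ _ _
      _ ≤ _ := by gcongr; exact (norm_pass_sub_pass_le hη hz _ _).trans ih

/-- The difference at `v` between the population gradient and the gradient at the data point `z`. -/
def noise (T : H →L[ℝ] H) (b v : H) (z : H × ℝ) : H := (T v - b) - (⟪v, z.1⟫_ℝ - z.2) • z.1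

lemma continuous_noise (T : H →L[ℝ] H) (b v : H) : Continuous (noise T b v) := by
  unfold noise; fun_prop

/-- The squared distance between an incremental and a population iterate grows, in one step, by a
term linear in the noise and a second order term. The cross term between the noise and the
contraction is absorbed by the decrease `η ⟪d, x⟫²` of `norm_sub_smul_inner_sq_le`. -/
lemma norm_gradStep_sub_gdStep_sq_le (T : H →L[ℝ] H) (b : H) (hη : 0 ≤ η) {z : H × ℝ}
    (hz : η * ‖z.1‖ ^ 2 ≤ 1) (u v : H) {B : ℝ} (hB : ‖noise T b v z‖ ≤ B) :
    ‖gradStep η z u - gdStep T b η v‖ ^ 2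
      ≤ ‖u - v‖ ^ 2 + 2 * η * ⟪u - v, noise T b v z⟫_ℝ + 2 * (η * B) ^ 2 := by
  set ζ := noise T b v z with hζ
  set d := u - v with hd
  have he : gradStep η z u - gdStep T b η v = (d - (η * ⟪d, z.1⟫_ℝ) • z.1) + η • ζ := by
    simp only [gradStep, gdStep, hζ, hd, noise, inner_sub_left, mul_sub, sub_smul, smul_sub,
      smul_smul]
    abel
  have h1 := norm_sub_smul_inner_sq_le hη hz d
  have hζB : ‖ζ‖ ^ 2 ≤ B ^ 2 := by gcongr
  have h2 : η * ⟪z.1, ζ⟫_ℝ ^ 2 ≤ B ^ 2 := by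
    have h3 := real_inner_mul_inner_self_le z.1 ζ
    rw [real_inner_self_eq_norm_sq, real_inner_self_eq_norm_sq] at h3
    calc η * ⟪z.1, ζ⟫_ℝ ^ 2 ≤ η * (‖z.1‖ ^ 2 * ‖ζ‖ ^ 2) := by rw [pow_two ⟪z.1, ζ⟫_ℝ]; gcongr
      _ = (η * ‖z.1‖ ^ 2) * ‖ζ‖ ^ 2 := by ring
      _ ≤ 1 * ‖ζ‖ ^ 2 := by gcongr
      _ ≤ B ^ 2 := by linarith
  rw [he, norm_add_sq_real, real_inner_smul_right, inner_sub_left (x := d), real_inner_smul_left,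
    norm_smul, mul_pow, Real.norm_eq_abs, sq_abs]
  have h4 : 0 ≤ η * (⟪d, z.1⟫_ℝ + η * ⟪z.1, ζ⟫_ℝ) ^ 2 := by positivity
  have h5 : η ^ 2 * (η * ⟪z.1, ζ⟫_ℝ ^ 2) ≤ η ^ 2 * B ^ 2 := by gcongr
  have h6 : η ^ 2 * ‖ζ‖ ^ 2 ≤ η ^ 2 * B ^ 2 := by gcongr
  nlinarith

end Pass

/-! ### Concentration of one pass around the population iteration -/

section Concentration

variable {H : Type*} [NormedAddCommGroup H] [InnerProductSpace ℝ H]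
  [MeasurableSpace H] [SecondCountableTopology H] [BorelSpace H]
  {ρ : Measure (H × ℝ)} [IsProbabilityMeasure ρ] {M κ η R : ℝ}

/-- An almost sure bound on the noise at points of norm at most `R`. -/
def noiseBound (M κ R : ℝ) : ℝ := 2 * ((√κ * R + M) * √κ)

lemma IsBoundedLaw.norm_noise_le (h : IsBoundedLaw M κ ρ) {v : H} (hv : ‖v‖ ≤ R) :
    ∀ᵐ z ∂ρ, ‖noise (covOp ρ) (crossVec ρ) v z‖ ≤ noiseBound M κ R := by
  have h1 : ‖covOp ρ v - crossVec ρ‖ ≤ (√κ * ‖v‖ + M) * √κ := by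
    rw [← h.integral_gradient]
    simpa using norm_integral_le_of_norm_le_const (h.norm_gradient_le v)
  have h2 : (√κ * ‖v‖ + M) * √κ ≤ (√κ * R + M) * √κ := by gcongr
  filter_upwards [h.norm_gradient_le v] with z hz
  rw [noise, noiseBound]
  linarith [norm_sub_le (covOp ρ v - crossVec ρ) ((⟪v, z.1⟫_ℝ - z.2) • z.1)]

variable [CompleteSpace H]

lemma IsBoundedLaw.integral_inner_noise (h : IsBoundedLaw M κ ρ) (d v : H) :
    ∫ z, ⟪d, noise (covOp ρ) (crossVec ρ) v z⟫_ℝ ∂ρ = 0 := by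
  have hi := h.integrable_gradient v
  simp only [noise]
  rw [integral_inner (f := fun z : H × ℝ => _ - _) ((integrable_const _).sub hi),
    integral_sub (integrable_const _) hi, h.integral_gradient]
  simp

lemma IsBoundedLaw.lintegral_exp_inner_noise_le (h : IsBoundedLaw M κ ρ) (d : H) {v : H}
    (hv : ‖v‖ ≤ R) (s : ℝ) :
    ∫⁻ z, ENNReal.ofReal (Real.exp (s * ⟪d, noise (covOp ρ) (crossVec ρ) v z⟫_ℝ)) ∂ρ
      ≤ ENNReal.ofReal (Real.exp (s ^ 2 * (noiseBound M κ R * ‖d‖) ^ 2 / 2)) := by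
  set B := noiseBound M κ R
  have hb : ∀ᵐ z ∂ρ, ⟪d, noise (covOp ρ) (crossVec ρ) v z⟫_ℝ
      ∈ Set.Icc (-(B * ‖d‖)) (B * ‖d‖) := by
    filter_upwards [h.norm_noise_le hv] with z hz
    rw [Set.mem_Icc, ← abs_le, mul_comm]
    exact (abs_real_inner_le_norm _ _).trans (by gcongr)
  have hm : AEMeasurable (fun z => ⟪d, noise (covOp ρ) (crossVec ρ) v z⟫_ℝ) ρ :=
    (continuous_const.inner (continuous_noise _ _ v)).aemeasurable
  have hsub := hasSubgaussianMGF_of_mem_Icc_of_integral_eq_zero hm hb (h.integral_inner_noise d v)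
  rw [← ofReal_integral_eq_lintegral_ofReal (hsub.integrable_exp_mul s)
    (.of_forall fun z => (Real.exp_pos _).le)]
  refine ENNReal.ofReal_le_ofReal ((hsub.mgf_le s).trans_eq ?_)
  congr 1
  push_cast
  rw [Real.norm_eq_abs, div_pow, sq_abs]
  ring

/-- Exponential moment of the squared distance after one step. -/
lemma IsBoundedLaw.lintegral_exp_step_le (h : IsBoundedLaw M κ ρ) (hη : 0 ≤ η) (hηκ : η * κ ≤ 1)
    (u : H) {v : H} (hv : ‖v‖ ≤ R) {a : ℝ} (ha : 0 ≤ a) :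
    ∫⁻ z, ENNReal.ofReal
        (Real.exp (a * ‖gradStep η z u - gdStep (covOp ρ) (crossVec ρ) η v‖ ^ 2)) ∂ρ
      ≤ ENNReal.ofReal (Real.exp ((a + 2 * a ^ 2 * (η * noiseBound M κ R) ^ 2) * ‖u - v‖ ^ 2
          + 2 * a * (η * noiseBound M κ R) ^ 2)) := by
  set B := noiseBound M κ R
  set d := u - v
  calc _ ≤ ∫⁻ z, ENNReal.ofReal (Real.exp (a * ‖d‖ ^ 2 + 2 * a * (η * B) ^ 2)) *
        ENNReal.ofReal (Real.exp (2 * a * η * ⟪d, noise (covOp ρ) (crossVec ρ) v z⟫_ℝ)) ∂ρ := by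
        refine lintegral_mono_ae ?_
        filter_upwards [h, h.norm_noise_le hv] with z hz hz'
        rw [← ENNReal.ofReal_mul (Real.exp_pos _).le, ← Real.exp_add]
        refine ENNReal.ofReal_le_ofReal (Real.exp_le_exp.2 ?_)
        have h1 := norm_gradStep_sub_gdStep_sq_le (covOp ρ) (crossVec ρ) hη
          ((mul_le_mul_of_nonneg_left hz.2 hη).trans hηκ) u v hz'
        have h2 := mul_le_mul_of_nonneg_left h1 ha
        linarith
    _ ≤ ENNReal.ofReal (Real.exp (a * ‖d‖ ^ 2 + 2 * a * (η * B) ^ 2)) *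
        ENNReal.ofReal (Real.exp ((2 * a * η) ^ 2 * (B * ‖d‖) ^ 2 / 2)) := by
        rw [lintegral_const_mul' _ _ ENNReal.ofReal_ne_top]
        gcongr
        exact h.lintegral_exp_inner_noise_le d hv _
    _ = _ := by
        rw [← ENNReal.ofReal_mul (Real.exp_pos _).le, ← Real.exp_add]
        congr 2
        ring

/-- Exponential moment of the squared distance after `m` steps. The first data point is integrated
last, so that all the others see a deterministic pair of starting points. Each step raises the
coefficient of the square by a factor close to one; the condition on `a` keeps it below `2 a`. -/
lemma IsBoundedLaw.lintegral_exp_pass_le (h : IsBoundedLaw M κ ρ) (hη : 0 ≤ η) (hηκ : η * κ ≤ 1)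
    {a : ℝ} (ha : 0 ≤ a) (m : ℕ) (ham : 8 * m * a * (η * noiseBound M κ R) ^ 2 ≤ 1) (u v : H)
    (hv : ∀ j < m, ‖(gdStep (covOp ρ) (crossVec ρ) η)^[j] v‖ ≤ R) :
    ∫⁻ z, ENNReal.ofReal
        (Real.exp (a * ‖pass η z u - (gdStep (covOp ρ) (crossVec ρ) η)^[m] v‖ ^ 2))
        ∂(Measure.pi fun _ : Fin m => ρ)
      ≤ ENNReal.ofReal (Real.exp ((a + 8 * m * a ^ 2 * (η * noiseBound M κ R) ^ 2) * ‖u - v‖ ^ 2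
          + 4 * m * a * (η * noiseBound M κ R) ^ 2)) := by
  set q := (η * noiseBound M κ R) ^ 2 with hq
  have hq0 : 0 ≤ q := sq_nonneg _
  induction m generalizing u v with
  | zero => simp [pass]
  | succ m ih =>
    have e := measurePreserving_piFinSuccAbove (fun _ : Fin (m + 1) => ρ) 0
    set f := gdStep (covOp ρ) (crossVec ρ) η with hf
    push_cast at ham
    have haq : 0 ≤ a * q := by positivity
    have ham' : 8 * (m : ℝ) * a * q ≤ 1 := by nlinarith
    set A := a + 8 * m * a ^ 2 * q with hA
    have hA0 : 0 ≤ A := by positivity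
    have hA2 : A ≤ 2 * a := by
      have := mul_le_mul_of_nonneg_left ham' ha
      nlinarith
    calc _ = ∫⁻ z, ENNReal.ofReal
          (Real.exp (a * ‖pass η z.2 (gradStep η z.1 u) - f^[m] (f v)‖ ^ 2))
          ∂(ρ.prod (Measure.pi fun _ : Fin m => ρ)) := by
          rw [← e.map_eq, lintegral_map_equiv]
          simp only [pass_succ, Function.iterate_succ_apply]
          rfl
      _ ≤ ∫⁻ z₀, ∫⁻ z, ENNReal.ofReal
          (Real.exp (a * ‖pass η z (gradStep η z₀ u) - f^[m] (f v)‖ ^ 2))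
          ∂(Measure.pi fun _ : Fin m => ρ) ∂ρ := lintegral_prod_le _
      _ ≤ ∫⁻ z₀, ENNReal.ofReal (Real.exp (4 * m * a * q)) *
          ENNReal.ofReal (Real.exp (A * ‖gradStep η z₀ u - f v‖ ^ 2)) ∂ρ := by
          refine lintegral_mono fun z₀ => (ih _ _ (fun j hj => ?_) ham').trans_eq ?_
          · rw [← Function.iterate_succ_apply]
            exact hv (j + 1) (by omega)
          · rw [← ENNReal.ofReal_mul (Real.exp_pos _).le, ← Real.exp_add, add_comm]
      _ ≤ ENNReal.ofReal (Real.exp (4 * m * a * q)) *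
          ENNReal.ofReal (Real.exp ((A + 2 * A ^ 2 * q) * ‖u - v‖ ^ 2 + 2 * A * q)) := by
          rw [lintegral_const_mul' _ _ ENNReal.ofReal_ne_top]
          gcongr
          exact h.lintegral_exp_step_le hη hηκ u (hv 0 (by omega)) hA0
      _ ≤ _ := by
          rw [← ENNReal.ofReal_mul (Real.exp_pos _).le, ← Real.exp_add]
          refine ENNReal.ofReal_le_ofReal (Real.exp_le_exp.2 ?_)
          have h1 : A ^ 2 * q ≤ (2 * a) ^ 2 * q := by gcongr
          have h2 : A * q ≤ 2 * a * q := by gcongr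
          have h3 : (A + 2 * A ^ 2 * q) * ‖u - v‖ ^ 2
              ≤ (a + 8 * (m + 1) * a ^ 2 * q) * ‖u - v‖ ^ 2 := by
            refine mul_le_mul_of_nonneg_right ?_ (sq_nonneg _)
            linarith
          push_cast
          linarith

/-- A sub-Gaussian tail for the error of one pass, free of the dimension. -/
lemma IsBoundedLaw.measure_pass_ge_le (h : IsBoundedLaw M κ ρ) (hη : 0 < η) (hηκ : η * κ ≤ 1)
    (hB : 0 < noiseBound M κ R) {n : ℕ} (hn : 0 < n) (v : H)
    (hv : ∀ j < n, ‖(gdStep (covOp ρ) (crossVec ρ) η)^[j] v‖ ≤ R) {r : ℝ} (hr : 0 ≤ r) :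
    (Measure.pi fun _ : Fin n => ρ)
        {z | r ≤ ‖pass η z v - (gdStep (covOp ρ) (crossVec ρ) η)^[n] v‖}
      ≤ ENNReal.ofReal (2 * Real.exp (-(r ^ 2 / (8 * n * (η * noiseBound M κ R) ^ 2)))) := by
  set q := (η * noiseBound M κ R) ^ 2 with hq
  set f := gdStep (covOp ρ) (crossVec ρ) η with hf
  have hq0 : 0 < q := by positivity
  have hn' : (0 : ℝ) < n := by exact_mod_cast hn
  set a := (8 * n * q)⁻¹ with ha
  have ha0 : 0 < a := by positivity
  have haq : 8 * n * a * q = 1 := by rw [ha]; field_simp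
  have h1 := h.lintegral_exp_pass_le hη.le hηκ ha0.le n haq.le v v hv
  have hmeas : Measurable fun z : Fin n → H × ℝ =>
      ENNReal.ofReal (Real.exp (a * ‖pass η z v - f^[n] v‖ ^ 2)) := by
    have := continuous_pass η n v
    exact ENNReal.measurable_ofReal.comp
      (Continuous.measurable (by fun_prop))
  have h2 := mul_meas_ge_le_lintegral (μ := Measure.pi fun _ : Fin n => ρ) hmeas
    (ENNReal.ofReal (Real.exp (a * r ^ 2)))
  have h3 : ENNReal.ofReal (Real.exp (a * r ^ 2)) * (Measure.pi fun _ : Fin n => ρ)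
      {z | r ≤ ‖pass η z v - f^[n] v‖} ≤ ENNReal.ofReal 2 := by
    refine (mul_le_mul_right (measure_mono fun z hz => ?_) _).trans (h2.trans (h1.trans ?_))
    · have hz' : r ≤ ‖pass η z v - f^[n] v‖ := hz
      exact ENNReal.ofReal_le_ofReal (Real.exp_le_exp.2 (by gcongr))
    · refine ENNReal.ofReal_le_ofReal ?_
      rw [sub_self, norm_zero, ← hq]
      have h4 : 4 * n * a * q = 1 / 2 := by linarith
      have h5 : Real.exp (1 / 2) ≤ 2 := by
        have h6 : Real.exp (1 / 2) ^ 2 = Real.exp 1 := by rw [← Real.exp_nat_mul]; norm_num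
        nlinarith [Real.exp_one_lt_d9, Real.exp_pos (1 / 2)]
      simpa [h4] using h5
  have he : r ^ 2 / (8 * n * q) = a * r ^ 2 := by rw [ha]; ring
  rw [he, Real.exp_neg, ← div_eq_mul_inv, ENNReal.ofReal_div_of_pos (Real.exp_pos _),
    ENNReal.le_div_iff_mul_le (.inl (by simp [Real.exp_pos])) (.inl ENNReal.ofReal_ne_top),
    mul_comm]
  exact h3

end Concentration

/-! ### Almost sure convergence of the incremental iterates -/

/-- The growth condition on `t` makes the exponents exceed `3 log n`, so the tails are summable. -/
lemma summable_mul_exp_of_growth {t : ℕ → ℕ} (ht_top : Tendsto t atTop atTop)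
    (ht_growth : Tendsto (fun n : ℕ => (t n : ℝ) ^ 3 * Real.log n / n) atTop (𝓝 0))
    {c : ℝ} (hc : 0 < c) :
    Summable fun n : ℕ => 2 * (t n : ℝ) * Real.exp (-(c * (n / (t n : ℝ) ^ 3))) := by
  have hg : Summable fun n : ℕ => 2 * (1 / (n : ℝ) ^ 2) :=
    (Real.summable_one_div_nat_pow.2 one_lt_two).mul_left 2
  refine Summable.of_norm_bounded_eventually_nat hg ?_
  filter_upwards [ht_top.eventually_ge_atTop 1, eventually_ge_atTop 3,
    ht_growth.eventually_lt_const (u := min 1 (c / 3)) (by positivity)] with n ht hn hlt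
  have ht1 : (1 : ℝ) ≤ t n := by exact_mod_cast ht
  have hn3 : (3 : ℝ) ≤ n := by exact_mod_cast hn
  have hn0 : (0 : ℝ) < n := by linarith
  have hlog : 1 ≤ Real.log n := by
    rw [Real.le_log_iff_exp_le hn0]
    linarith [Real.exp_one_lt_d9]
  rw [div_lt_iff₀ hn0] at hlt
  have hcube : (t n : ℝ) ≤ (t n : ℝ) ^ 3 := le_self_pow₀ ht1 three_ne_zero
  have htn : (t n : ℝ) ≤ n := by
    have h1 : min 1 (c / 3) * (n : ℝ) ≤ 1 * n := by gcongr; exact min_le_left _ _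
    nlinarith
  have hexp : 3 * Real.log n ≤ c * (n / (t n : ℝ) ^ 3) := by
    have h1 : min 1 (c / 3) * (n : ℝ) ≤ c / 3 * n := by gcongr; exact min_le_right _ _
    rw [← mul_div_assoc, le_div_iff₀ (by positivity)]
    linarith
  have he : Real.exp (-(c * (n / (t n : ℝ) ^ 3))) ≤ ((n : ℝ) ^ 3)⁻¹ := by
    calc Real.exp (-(c * (n / (t n : ℝ) ^ 3))) ≤ Real.exp (-(3 * Real.log n)) := by gcongr
      _ = ((n : ℝ) ^ 3)⁻¹ := by
        rw [Real.exp_neg, ← Real.exp_log hn0, ← Real.exp_nat_mul, Real.exp_log hn0]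
        norm_num
  rw [Real.norm_of_nonneg (by positivity)]
  calc 2 * (t n : ℝ) * Real.exp (-(c * (n / (t n : ℝ) ^ 3))) ≤ 2 * n * ((n : ℝ) ^ 3)⁻¹ := by gcongr
    _ = 2 * (1 / (n : ℝ) ^ 2) := by field_simp

section AlmostSure

variable {H : Type*} [NormedAddCommGroup H] [InnerProductSpace ℝ H] [MeasurableSpace H]
  {ρ : Measure (H × ℝ)} {M κ γ : ℝ}

/-- A constant `C` such that `C √t` bounds the noise along the first `t` epochs of the population
iteration started at `w`. -/
def epochNoise (M κ γ : ℝ) (ρ : Measure (H × ℝ)) (w : H) : ℝ :=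
  noiseBound M κ (‖w‖ + √(γ * risk ρ w))

lemma epochNoise_pos (hM : 0 < M) (hκ : 0 < κ) (w : H) : 0 < epochNoise M κ γ ρ w := by
  unfold epochNoise noiseBound
  positivity

lemma noiseBound_le_epochNoise (hM : 0 < M) (w : H) {t : ℕ} (ht : 0 < t) :
    noiseBound M κ (‖w‖ + √(t * γ * risk ρ w)) ≤ epochNoise M κ γ ρ w * √t := by
  have h1 : (1 : ℝ) ≤ √t := Real.one_le_sqrt.2 (by exact_mod_cast ht)
  have h2 : √(t * γ * risk ρ w) = √(γ * risk ρ w) * √t := by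
    rw [mul_assoc, Real.sqrt_mul (Nat.cast_nonneg t), mul_comm]
  have h3 : √κ * (‖w‖ + √(γ * risk ρ w) * √t) + M
      ≤ (√κ * (‖w‖ + √(γ * risk ρ w)) + M) * √t := by
    have h4 : 0 ≤ (√κ * ‖w‖ + M) * (√t - 1) := mul_nonneg (by positivity) (by linarith)
    linarith
  rw [epochNoise, noiseBound, noiseBound, h2]
  have h5 := mul_le_mul_of_nonneg_right h3 (Real.sqrt_nonneg κ)
  linarith

variable [CompleteSpace H] [SecondCountableTopology H] [BorelSpace H] [IsProbabilityMeasure ρ]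

lemma IsBoundedLaw.neg_le_quad (h : IsBoundedLaw M κ ρ) (w : H) :
    -∫ z, z.2 ^ 2 ∂ρ ≤ quad (covOp ρ) (crossVec ρ) w := by
  have h1 : 0 ≤ risk ρ w := integral_nonneg fun z => sq_nonneg _
  linarith [h.risk_eq w]

/-- The population iteration moves at most by the square root of the total elapsed step size, even
if it diverges. -/
lemma IsBoundedLaw.norm_iterate_le (h : IsBoundedLaw M κ ρ) {η : ℝ} (hη : 0 ≤ η)
    (hηκ : η * κ ≤ 1) (w : H) (k : ℕ) :
    ‖(gdStep (covOp ρ) (crossVec ρ) η)^[k] w‖ ≤ ‖w‖ + √(k * η * risk ρ w) := by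
  set v := (gdStep (covOp ρ) (crossVec ρ) η)^[k] w with hv
  have h1 := norm_iterate_sub_sq_le (b := crossVec ρ) h.isBetweenZeroAnd_covOp hη hηκ w w k
  rw [← hv, sub_self, norm_zero] at h1
  have h2 : k * η * (quad (covOp ρ) (crossVec ρ) w - quad (covOp ρ) (crossVec ρ) v)
      ≤ k * η * risk ρ w := by
    refine mul_le_mul_of_nonneg_left ?_ (by positivity)
    linarith [h.neg_le_quad v, h.risk_eq w]
  have h3 : ‖v - w‖ ≤ √(k * η * risk ρ w) := Real.le_sqrt_of_sq_le (by linarith)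
  linarith [norm_le_norm_add_norm_sub' v w]

variable {Ω : Type*} [MeasurableSpace Ω] {P : Measure Ω} [IsProbabilityMeasure P]

/-- Deviation of `t` epochs of the incremental iteration from `n t` population steps of size
`γ / n`: a union bound over the epochs. -/
lemma IsBoundedLaw.measure_iterate_sub_ge_le (h : IsBoundedLaw M κ ρ) (hM : 0 < M) (hκ : 0 < κ)
    (hγ : 0 < γ) (hγκ : γ * κ ≤ 1) {n : ℕ} (hn : 0 < n) {Z : Fin n → Ω → H × ℝ}
    (hZ_meas : ∀ i, Measurable (Z i)) (hZ_law : ∀ i, P.map (Z i) = ρ) (hZ_indep : iIndepFun Z P)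
    (w : H) {t : ℕ} (ht : 0 < t) {δ : ℝ} (hδ : 0 ≤ δ) :
    P {ω | δ ≤ ‖iterate γ (fun i => Z i ω) w t
        - (gdStep (covOp ρ) (crossVec ρ) (γ / n))^[n * t] w‖}
      ≤ ENNReal.ofReal (2 * t *
          Real.exp (-(δ ^ 2 / (8 * γ ^ 2 * epochNoise M κ γ ρ w ^ 2) * (n / t ^ 3)))) := by
  set f := gdStep (covOp ρ) (crossVec ρ) (γ / n) with hf
  set C := epochNoise M κ γ ρ w
  have hC : 0 < C := epochNoise_pos hM hκ w
  set R := ‖w‖ + √(t * γ * risk ρ w) with hR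
  have hn' : (1 : ℝ) ≤ n := by exact_mod_cast hn
  have ht' : (0 : ℝ) < t := by exact_mod_cast ht
  have hrisk : 0 ≤ risk ρ w := integral_nonneg fun z => sq_nonneg _
  have hη : 0 < γ / n := by positivity
  have hηκ : γ / n * κ ≤ 1 :=
    (mul_le_mul_of_nonneg_right (div_le_self hγ.le hn') hκ.le).trans hγκ
  have hB : 0 < noiseBound M κ R := by unfold noiseBound; positivity
  -- the points at which the noise is evaluated
  have hbound : ∀ s < t, ∀ j < n, ‖f^[j] ((f^[n])^[s] w)‖ ≤ R := by
    intro s hs j hj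
    rw [← Function.iterate_mul, ← Function.iterate_add_apply]
    refine (h.norm_iterate_le hη.le hηκ w _).trans ?_
    have h1 : j + n * s ≤ n * t := by nlinarith
    have h2 : ((j + n * s : ℕ) : ℝ) * (γ / n) ≤ t * γ := by
      calc ((j + n * s : ℕ) : ℝ) * (γ / n) ≤ ((n * t : ℕ) : ℝ) * (γ / n) := by gcongr
        _ = t * γ := by push_cast; field_simp
    rw [hR]
    gcongr
  have hpi : P.map (fun ω i => Z i ω) = Measure.pi fun _ : Fin n => ρ := by
    rw [(iIndepFun_iff_map_fun_eq_pi_map fun i => (hZ_meas i).aemeasurable).1 hZ_indep]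
    simp only [hZ_law]
  have hmeasZ : Measurable fun ω i => Z i ω := measurable_pi_lambda _ hZ_meas
  have hone : ∀ s < t, P {ω | δ / t ≤ ‖pass (γ / n) (fun i => Z i ω) ((f^[n])^[s] w)
      - f^[n] ((f^[n])^[s] w)‖}
      ≤ ENNReal.ofReal (2 * Real.exp (-(δ ^ 2 / (8 * γ ^ 2 * C ^ 2) * (n / t ^ 3)))) := by
    intro s hs
    refine (Measure.le_map_apply hmeasZ.aemeasurable
      {z | δ / t ≤ ‖pass (γ / n) z ((f^[n])^[s] w) - f^[n] ((f^[n])^[s] w)‖}).trans ?_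
    rw [hpi]
    refine (h.measure_pass_ge_le hη hηκ hB hn _ (hbound s hs) (by positivity)).trans ?_
    refine ENNReal.ofReal_le_ofReal ?_
    have h1 : noiseBound M κ R ^ 2 ≤ C ^ 2 * t := by
      calc noiseBound M κ R ^ 2 ≤ (C * √t) ^ 2 := by
            gcongr
            exact noiseBound_le_epochNoise hM w ht
        _ = C ^ 2 * t := by rw [mul_pow, Real.sq_sqrt ht'.le]
    have h2 : δ ^ 2 / (8 * γ ^ 2 * C ^ 2) * (n / t ^ 3)
        ≤ (δ / t) ^ 2 / (8 * n * (γ / n * noiseBound M κ R) ^ 2) := by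
      calc δ ^ 2 / (8 * γ ^ 2 * C ^ 2) * (n / t ^ 3)
          = (δ / t) ^ 2 / (8 * n * (γ / n) ^ 2 * (C ^ 2 * t)) := by field_simp
        _ ≤ (δ / t) ^ 2 / (8 * n * (γ / n) ^ 2 * noiseBound M κ R ^ 2) := by gcongr
        _ = _ := by rw [mul_pow]; ring
    gcongr
  have hz : ∀ᵐ ω ∂P, ∀ i, γ / n * ‖(Z i ω).1‖ ^ 2 ≤ 1 := by
    rw [ae_all_iff]
    intro i
    have h1 : ∀ᵐ z ∂(P.map (Z i)), |z.2| ≤ M ∧ ‖z.1‖ ^ 2 ≤ κ := by rw [hZ_law i]; exact h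
    filter_upwards [ae_of_ae_map (hZ_meas i).aemeasurable h1] with ω hω
    exact (mul_le_mul_of_nonneg_left hω.2 hη.le).trans hηκ
  calc _ ≤ P (⋃ s ∈ Finset.range t, {ω | δ / t ≤ ‖pass (γ / n) (fun i => Z i ω) ((f^[n])^[s] w)
      - f^[n] ((f^[n])^[s] w)‖}) := by
        refine measure_mono_ae ?_
        filter_upwards [hz] with ω hω hωδ
        have hωδ' : δ ≤ _ := hωδ
        rw [iterate_eq_pass, Function.iterate_mul] at hωδ'
        have h1 := hωδ'.trans (norm_iterate_pass_sub_le hη.le hω (f^[n]) w t)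
        change ω ∈ ⋃ s ∈ Finset.range t, _
        simp only [Set.mem_iUnion]
        obtain ⟨s, hs, hs'⟩ := Finset.exists_le_of_sum_le (s := Finset.range t)
          (f := fun _ => δ / t)
          (g := fun s => ‖pass (γ / n) (fun i => Z i ω) ((f^[n])^[s] w) - f^[n] ((f^[n])^[s] w)‖)
          (Finset.nonempty_range_iff.2 ht.ne')
          (by rw [Finset.sum_const, Finset.card_range, nsmul_eq_mul, mul_div_cancel₀ _ ht'.ne']
              exact h1)
        exact ⟨s, hs, hs'⟩
    _ ≤ ∑ s ∈ Finset.range t, P {ω | δ / t ≤ ‖pass (γ / n) (fun i => Z i ω) ((f^[n])^[s] w)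
      - f^[n] ((f^[n])^[s] w)‖} := measure_biUnion_finset_le _ _
    _ ≤ ∑ s ∈ Finset.range t,
        ENNReal.ofReal (2 * Real.exp (-(δ ^ 2 / (8 * γ ^ 2 * C ^ 2) * (n / t ^ 3)))) :=
        Finset.sum_le_sum fun s hs => hone s (Finset.mem_range.1 hs)
    _ = _ := by
        rw [Finset.sum_const, Finset.card_range, nsmul_eq_mul, ← ENNReal.ofReal_natCast,
          ← ENNReal.ofReal_mul (Nat.cast_nonneg t)]
        congr 1
        ring

/-- Almost surely, the incremental iterates are asymptotic to the population iterates; by the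
Borel–Cantelli lemma, whatever the joint law of the training sets. -/
lemma IsBoundedLaw.ae_tendsto_iterate_sub (h : IsBoundedLaw M κ ρ) (hM : 0 < M) (hκ : 0 < κ)
    (hγ : 0 < γ) (hγκ : γ * κ ≤ 1) {Z : (n : ℕ) → Fin n → Ω → H × ℝ}
    (hZ_meas : ∀ n i, Measurable (Z n i)) (hZ_law : ∀ n i, P.map (Z n i) = ρ)
    (hZ_indep : ∀ n, iIndepFun (Z n) P) {t : ℕ → ℕ} (ht_top : Tendsto t atTop atTop)
    (ht_growth : Tendsto (fun n : ℕ => (t n : ℝ) ^ 3 * Real.log n / n) atTop (𝓝 0)) (w : H) :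
    ∀ᵐ ω ∂P, Tendsto (fun n : ℕ => ‖iterate γ (fun i => Z n i ω) w (t n)
        - (gdStep (covOp ρ) (crossVec ρ) (γ / n))^[n * t n] w‖) atTop (𝓝 0) := by
  have hC : 0 < epochNoise M κ γ ρ w := epochNoise_pos hM hκ w
  have key : ∀ m : ℕ, ∀ᵐ ω ∂P, ∀ᶠ n : ℕ in atTop, ‖iterate γ (fun i => Z n i ω) w (t n)
        - (gdStep (covOp ρ) (crossVec ρ) (γ / n))^[n * t n] w‖ < 1 / ((m : ℝ) + 1) := by
    intro m
    have hδ : (0 : ℝ) < 1 / ((m : ℝ) + 1) := by positivity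
    set δ := 1 / ((m : ℝ) + 1)
    have hsum := summable_mul_exp_of_growth ht_top ht_growth
      (c := δ ^ 2 / (8 * γ ^ 2 * epochNoise M κ γ ρ w ^ 2)) (by positivity)
    -- the conditions `0 < n` and `0 < t n` exclude the finitely many `n` without a tail bound
    have hbc := ae_eventually_notMem (μ := P) (s := fun n : ℕ => {ω | 0 < n ∧ 0 < t n ∧
      δ ≤ ‖iterate γ (fun i => Z n i ω) w (t n)
        - (gdStep (covOp ρ) (crossVec ρ) (γ / n))^[n * t n] w‖}) (by
      refine ne_top_of_le_ne_top hsum.tsum_ofReal_ne_top (ENNReal.tsum_le_tsum fun n => ?_)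
      by_cases hn : 0 < n ∧ 0 < t n
      · refine (measure_mono fun ω hω => ?_).trans (h.measure_iterate_sub_ge_le hM hκ hγ hγκ hn.1
          (hZ_meas n) (hZ_law n) (hZ_indep n) w hn.2 hδ.le)
        exact hω.2.2
      · refine le_of_eq_of_le ?_ zero_le
        convert measure_empty (μ := P)
        ext ω
        simp only [Set.mem_ofPred_eq, Set.mem_empty_iff_false, iff_false]
        tauto)
    filter_upwards [hbc] with ω hω
    filter_upwards [hω, eventually_gt_atTop 0, ht_top.eventually_gt_atTop 0] with n hn hn0 ht0
    by_contra! hcon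
    exact hn ⟨hn0, ht0, hcon⟩
  rw [← ae_all_iff] at key
  filter_upwards [key] with ω hω
  rw [Metric.tendsto_nhds]
  intro ε hε
  obtain ⟨m, hm⟩ := exists_nat_one_div_lt hε
  filter_upwards [hω m] with n hn
  rw [Real.dist_eq, sub_zero, abs_norm]
  exact hn.trans hm

end AlmostSure

end IncrementalLearning

end

open IncrementalLearning

theorem theorem1
    {H : Type*} [NormedAddCommGroup H] [InnerProductSpace ℝ H] [CompleteSpace H]
    [TopologicalSpace.SeparableSpace H] [MeasurableSpace H] [BorelSpace H]
    {Ω : Type*} [MeasurableSpace Ω] (P : Measure Ω) [IsProbabilityMeasure P]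
    -- the distribution of the pair (X, Y)
    (ρ : Measure (H × ℝ)) [IsProbabilityMeasure ρ]
    -- for every n, a training set of n independent pairs with distribution ρ
    (Z : (n : ℕ) → Fin n → Ω → H × ℝ)
    (hZ_meas : ∀ n i, Measurable (Z n i))
    (hZ_law : ∀ n i, P.map (Z n i) = ρ)
    (hZ_indep : ∀ n, iIndepFun (Z n) P)
    -- bounded outputs and inputs
    (M κ : ℝ) (hM : 0 < M) (hκ : 0 < κ)
    (hy : ∀ᵐ z ∂ρ, |z.2| ≤ M)
    (hx : ∀ᵐ x ∂ρ.fst, ‖x‖ ^ 2 ≤ κ)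
    -- the step size
    (γ : ℝ) (hγ_pos : 0 < γ) (hγ_le : γ ≤ κ⁻¹)
    -- the stopping rule
    (t : ℕ → ℕ) (ht_top : Tendsto t atTop atTop)
    (ht_growth : Tendsto (fun n : ℕ => (t n : ℝ) ^ 3 * Real.log n / n) atTop (𝓝 0)) :
    -- (i) the excess risk tends to zero almost surely, for every initial point
    (∀ w₀ : H, ∀ᵐ ω ∂P, Tendsto
      (fun n : ℕ =>
        IncrementalLearning.risk ρ
            (IncrementalLearning.iterate γ (fun i => Z n i ω) w₀ (t n))
          - ⨅ w : H, IncrementalLearning.risk ρ w)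
      atTop (𝓝 0)) ∧
    -- (ii) if minimizers exist, there is exactly one of minimal norm, and the iterates started
    -- at zero converge to it almost surely
    ((IncrementalLearning.minimizers ρ).Nonempty →
      (∃! wd : H, IncrementalLearning.IsMinNormMinimizer ρ wd) ∧
      ∀ wd : H, IncrementalLearning.IsMinNormMinimizer ρ wd →
        ∀ᵐ ω ∂P, Tendsto
          (fun n : ℕ => ‖IncrementalLearning.iterate γ (fun i => Z n i ω) 0 (t n) - wd‖)
          atTop (𝓝 0)) := by
  have : SecondCountableTopology H := UniformSpace.secondCountable_of_separable H
  have h : IsBoundedLaw M κ ρ := by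
    filter_upwards [hy, ae_of_ae_map measurable_fst.aemeasurable hx] with z h1 h2 using ⟨h1, h2⟩
  have hγκ : γ * κ ≤ 1 := by rwa [← le_div_iff₀ hκ, one_div]
  have hT := h.isBetweenZeroAnd_covOp
  have hclose := h.ae_tendsto_iterate_sub hM hκ hγ_pos hγκ hZ_meas hZ_law hZ_indep ht_top ht_growth
  -- for `n = 0` the step size `γ / n` is zero
  have hs' : ∀ n : ℕ, 0 ≤ γ / n ∧ γ / n * κ ≤ 1 := by
    intro n
    refine ⟨by positivity, ?_⟩
    rcases n.eq_zero_or_pos with rfl | hn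
    · simp
    · exact (mul_le_mul_of_nonneg_right (div_le_self hγ_pos.le (by exact_mod_cast hn)) hκ.le).trans
        hγκ
  have hs : ∀ᶠ n : ℕ in atTop, 0 ≤ γ / n ∧ γ / n * κ ≤ 1 := .of_forall hs'
  have hks : Tendsto (fun n : ℕ => ((n * t n : ℕ) : ℝ) * (γ / n)) atTop atTop := by
    refine ((tendsto_natCast_atTop_atTop.comp ht_top).atTop_mul_const hγ_pos).congr' ?_
    filter_upwards [eventually_gt_atTop 0] with n hn
    have hn' : (n : ℝ) ≠ 0 := by exact_mod_cast hn.ne'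
    push_cast
    simp only [Function.comp]
    field_simp
  refine ⟨fun w₀ => ?_, fun hne => ?_⟩
  · filter_upwards [hclose w₀] with ω hω
    have hbdd : BddBelow (Set.range (quad (covOp ρ) (crossVec ρ))) :=
      ⟨_, Set.forall_mem_range.2 h.neg_le_quad⟩
    have h1 := tendsto_quad_iterate hT hbdd hs hks w₀
    have h2 := tendsto_quad_sub_quad hT hκ h.neg_le_quad
      (Q := quad (covOp ρ) (crossVec ρ) w₀)
      (.of_forall fun n => quad_iterate_antitone hT (hs' n).1 (hs' n).2 w₀ (Nat.zero_le _)) hω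
    have hinf : ⨅ w, risk ρ w = (⨅ w, quad (covOp ρ) (crossVec ρ) w) + ∫ z, z.2 ^ 2 ∂ρ := by
      simp_rw [h.risk_eq]
      exact (ciInf_add hbdd _).symm
    have h3 := (h2.add h1).sub_const (⨅ w, quad (covOp ρ) (crossVec ρ) w)
    rw [zero_add, sub_self] at h3
    refine h3.congr fun n => ?_
    rw [hinf, h.risk_eq]
    ring
  · obtain ⟨w, hw⟩ := hne
    obtain ⟨u, hu, hker, hmin⟩ := exists_minNorm_solution (covOp ρ) (crossVec ρ)
      ⟨w, (h.mem_minimizers_iff hκ w).1 hw⟩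
    have huniq : ∀ v, IsMinNormMinimizer ρ v → v = u := fun v hv =>
      (hmin v ((h.mem_minimizers_iff hκ v).1 hv.1)).2 (hv.2 ((h.mem_minimizers_iff hκ u).2 hu))
    refine ⟨⟨u, ⟨(h.mem_minimizers_iff hκ u).2 hu, fun v hv =>
      (hmin v ((h.mem_minimizers_iff hκ v).1 hv)).1⟩, huniq⟩, fun v hv => ?_⟩
    rw [huniq v hv]
    filter_upwards [hclose 0] with ω hω
    have h1 := tendsto_iff_norm_sub_tendsto_zero.1
      (tendsto_iterate_gdStep hT hκ hs hks hu hker)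
    have h2 := hω.add h1
    rw [add_zero] at h2
    exact squeeze_zero (fun n => norm_nonneg _)
      (fun n => norm_sub_le_norm_sub_add_norm_sub _ _ _) h2
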